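/- Let $\mathbb K=\mathbb R$ or $\mathbb C$. Embed $\mathbb K^n$ in $\mathbb K\mathbb P^n$ by $x\mapsto[x:1]$, let $H_\infty=\{[v:0]\}$ be the hyperplane at infinity, and for $X\subset\mathbb K^n$ let $X^\infty=\overline{X}\cap H_\infty$, where $\overline X$ is the closure of $X$ in $\mathbb K\mathbb P^n$ for the Euclidean topology. Dimensions are over $\mathbb K$ (the dimension of a semialgebraic set if $\mathbb K=\mathbb R$, the complex dimension of an algebraic set if $\mathbb K=\mathbb C$), and $\dim\emptyset=-1$. A mapping $\varphi:\mathbb K^n\to\mathbb K^p$ is proper at $c\in\mathbb K^p$ if there is a neighbourhood $V$ of $c$ such that the restriction $\varphi^{-1}(V)\to V$ is proper (empty mappings are proper). The point $c$ is a Lipschitz trivial value of $\varphi$ if there are a neighbourhood $V$ of $c$ and a homeomorphism $H:\varphi^{-1}(c)\times V\to\varphi^{-1}(V)$ with $\varphi(H(x,t))=t$ for all $(x,t)$ which is bi-Lipschitz with respect to the distances induced by the Euclidean distances and the product distance. **Theorem.** Let $f:\mathbb K^n\to\mathbb K^p$ be a polynomial mapping (with coefficients in $\mathbb K$), let $c\in\mathbb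 K^p$, put $F_c=f^{-1}(c)$, and suppose that $\dim F_c^\infty=n-1-m$ with $m\in\mathbb N$. If $c$ is a Lipschitz trivial value of $f$, then there exist a polynomial mapping $g:\mathbb K^m\to\mathbb K^p$ which is proper at $c$ and a surjective $\mathbb K$-linear mapping $\pi:\mathbb K^n\to\mathbb K^m$ such that $f=g\circ\pi$. -/

import Mathlib

open scoped Topology LinearAlgebra.Projectivization

/-- The quotient topology on the projectivization of a topological vector space. -/
instance projectivizationTopology {K V : Type*} [DivisionRing K] [AddCommGroup V] [Module K V]
    [TopologicalSpace V] : TopologicalSpace (ℙ K V) :=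
  TopologicalSpace.coinduced (Projectivization.mk' K) inferInstance

noncomputable section

namespace LipschitzTrivial

variable {K : Type*} [RCLike K] {n p : ℕ}

/-- The projective space `K ℙⁿ`, with homogeneous coordinates indexed by `Fin (n + 1)`. -/
abbrev ProjSpace (K : Type*) [RCLike K] (n : ℕ) : Type _ := ℙ K (Fin (n + 1) → K)

/-- The embedding `x ↦ [x : 1]` of `Kⁿ` into `K ℙⁿ`. -/
def embed (x : EuclideanSpace K (Fin n)) : ProjSpace K n :=
  Projectivization.mk K (Fin.snoc (α := fun _ => K) x 1) (fun h => by
    simpa using congrFun h (Fin.last n))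

/-- The hyperplane at infinity, which is the set of the points `[v : 0]`. -/
def hyperplaneAtInfinity (K : Type*) [RCLike K] (n : ℕ) : Set (ProjSpace K n) :=
  {P | P.rep (Fin.last n) = 0}

/-- The accumulation set at infinity of a subset of `Kⁿ`. The closure is taken in `K ℙⁿ` for the
Euclidean (not the Zariski) topology. -/
def accumulationAtInfinity (X : Set (EuclideanSpace K (Fin n))) : Set (ProjSpace K n) :=
  closure (embed '' X) ∩ hyperplaneAtInfinity K n

/-- The `K`-cone over a subset of projective space, with its vertex at the origin.
The cone over the empty set is `{0}`. -/
def cone {N : ℕ} (S : Set (ℙ K (Fin N → K))) : Set (Fin N → K) :=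
  {v | ∀ hv : v ≠ 0, Projectivization.mk K v hv ∈ S}

/-- The homogeneous coordinate ring of (the Zariski closure of) a subset of projective space. -/
abbrev CoordRing {N : ℕ} (S : Set (ℙ K (Fin N → K))) : Type _ :=
  MvPolynomial (Fin N) K ⧸ MvPolynomial.vanishingIdeal K (cone S)

/-- The dimension over `K` of a subset of projective space: the Krull dimension of its homogeneous
coordinate ring, minus one. This is the usual dimension of a complex algebraic set, and the usual
dimension of a real semialgebraic set (which is that of its Zariski closure). The empty set has
dimension `-1`. No default value occurs here, see `ringKrullDim_coordRing`. -/
def projDim {N : ℕ} (S : Set (ℙ K (Fin N → K))) : ℤ :=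
  (((ringKrullDim (CoordRing S)).unbotD 0).toNat : ℤ) - 1

/-- The Krull dimension of the coordinate ring is the natural number `projDim S + 1`. -/
theorem ringKrullDim_coordRing {N : ℕ} (S : Set (ℙ K (Fin N → K))) :
    ∃ d : ℕ, ringKrullDim (CoordRing S) = d ∧ projDim S = (d : ℤ) - 1 := by
  have hne : MvPolynomial.vanishingIdeal K (cone S) ≠ ⊤ := fun h => by
    have h1 : (1 : MvPolynomial (Fin N) K) ∈ MvPolynomial.vanishingIdeal K (cone S) :=
      h ▸ Submodule.mem_top
    have h2 := h1 0 (fun hv => absurd rfl hv)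
    simp at h2
  have : Nontrivial (CoordRing S) := Ideal.Quotient.nontrivial_iff.mpr hne
  have hle : ringKrullDim (CoordRing S) ≤ (N : ℕ) := by
    refine (ringKrullDim_quotient_le _).trans ?_
    rw [MvPolynomial.ringKrullDim_of_isNoetherianRing]
    simp
  have hge : 0 ≤ ringKrullDim (CoordRing S) := ringKrullDim_nonneg_of_nontrivial
  unfold projDim
  generalize ringKrullDim (CoordRing S) = r at hle hge
  induction r using WithBot.recBotCoe with
  | bot => simp at hge
  | coe e =>
    have he : e ≤ (N : ℕ∞) := by exact_mod_cast hle
    obtain ⟨d, rfl⟩ := ENat.ne_top_iff_exists.mp (ne_top_of_le_ne_top (ENat.natCast_ne_top N) he)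
    exact ⟨d, rfl, by simp⟩

/-- The mapping is given by polynomials with coefficients in `K`. -/
def IsPolynomialMap (f : EuclideanSpace K (Fin n) → EuclideanSpace K (Fin p)) : Prop :=
  ∃ P : Fin p → MvPolynomial (Fin n) K, ∀ x i, f x i = MvPolynomial.eval x (P i)

/-- Properness at the value `c`: over some neighbourhood `V` of `c`, the restriction
`φ⁻¹(V) → V` is proper. -/
def IsProperAt (φ : EuclideanSpace K (Fin n) → EuclideanSpace K (Fin p))
    (c : EuclideanSpace K (Fin p)) : Prop :=
  ∃ V ∈ 𝓝 c, IsProperMap (V.restrictPreimage φ)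

/-- `c` is a Lipschitz trivial value of `φ`: there are a neighbourhood `V` of `c` and a
trivializing homeomorphism `H : φ⁻¹(c) × V → φ⁻¹(V)` with `φ (H (x, t)) = t` which is
bi-Lipschitz for the restricted Euclidean distances and the (maximum) product distance. -/
def IsLipschitzTrivialValue (φ : EuclideanSpace K (Fin n) → EuclideanSpace K (Fin p))
    (c : EuclideanSpace K (Fin p)) : Prop :=
  ∃ V ∈ 𝓝 c, ∃ H : ↥(φ ⁻¹' {c}) × ↥V ≃ₜ ↥(φ ⁻¹' V),
    (∀ x t, φ (H (x, t)) = t) ∧ ∃ L, LipschitzWith L H ∧ LipschitzWith L H.symm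

end LipschitzTrivial

end

/-! Let `F` be the fibre over `c` and `N` the common kernel of the linear forms bounded on `F`. By
duality `F` is bounded modulo `N`, so everything reduces to the invariance of `f` under `N`.
Lipschitz triviality makes `f` bounded on a uniform neighbourhood of `F` (`exists_tube`). Being
polynomial, `f` is determined along a line by finitely many small steps, so all its translates are
bounded on `F` (`boundedOn_translate_eval`). By induction on the degree, the differences of `f` are
`N`-invariant, so `f` is affine along `N`; its linear part extends to a form bounded on `F`, hence
vanishes on `N` (`DiffDegreeLT.invariant`). Then `F + N = F`, the points at infinity of `F` form the
projective space of `N`, and `dim N = n - m`. So `f` descends to `Kⁿ / N ≅ Kᵐ`. The induced map is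
proper at `c` because nearby fibres stay at bounded distance from `F`. -/

namespace LipschitzTrivial

/-! ### Polynomial degree through finite differences -/

section FiniteDifferences

variable {E K : Type*} [AddCommGroup E] [CommRing K]

/-- All `d`-fold finite differences of `φ`, in arbitrary directions, vanish. -/
def DiffDegreeLT : ℕ → (E → K) → Prop
  | 0, φ => ∀ x, φ x = 0
  | d + 1, φ => ∀ w, DiffDegreeLT d (fun x => φ (x + w) - φ x)

theorem DiffDegreeLT.zero (d : ℕ) : DiffDegreeLT d (fun _ : E => (0 : K)) := by
  induction d with
  | zero => intro x; rfl
  | succ d ih => intro w; simpa using ih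

theorem DiffDegreeLT.succ {d : ℕ} {φ : E → K} (h : DiffDegreeLT d φ) : DiffDegreeLT (d + 1) φ := by
  induction d generalizing φ with
  | zero => intro w x; simp [h (x + w), h x]
  | succ d ih => intro w; exact ih (h w)

theorem DiffDegreeLT.mono {d e : ℕ} {φ : E → K} (h : DiffDegreeLT d φ) (hde : d ≤ e) :
    DiffDegreeLT e φ := by
  induction e, hde using Nat.le_induction with
  | base => exact h
  | succ e _ ih => exact ih.succ

theorem DiffDegreeLT.add {d : ℕ} {φ ψ : E → K} (hφ : DiffDegreeLT d φ) (hψ : DiffDegreeLT d ψ) :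
    DiffDegreeLT d (fun x => φ x + ψ x) := by
  induction d generalizing φ ψ with
  | zero => intro x; simp [hφ x, hψ x]
  | succ d ih =>
    intro w
    convert ih (hφ w) (hψ w) using 2
    ring

theorem DiffDegreeLT.translate {d : ℕ} {φ : E → K} (h : DiffDegreeLT d φ) (w : E) :
    DiffDegreeLT d (fun x => φ (x + w)) := by
  induction d generalizing φ with
  | zero => intro x; exact h _
  | succ d ih =>
    intro u
    convert ih (h u) using 4
    abel

theorem DiffDegreeLT.mul {d e : ℕ} {φ ψ : E → K} (hφ : DiffDegreeLT d φ) (hψ : DiffDegreeLT e ψ) :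
    DiffDegreeLT (d + e) (fun x => φ x * ψ x) := by
  induction hs : d + e generalizing d e φ ψ with
  | zero =>
    obtain ⟨rfl, rfl⟩ := Nat.add_eq_zero_iff.mp hs
    intro x
    simp [hφ x]
  | succ s ih =>
    rcases d with _ | d
    · have : (fun x => φ x * ψ x) = fun _ => 0 := by ext x; simp [hφ x]
      rw [this]
      exact .zero _
    rcases e with _ | e
    · have : (fun x => φ x * ψ x) = fun _ => 0 := by ext x; simp [hψ x]
      rw [this]
      exact .zero _
    intro w
    -- Discrete Leibniz rule: `Δ(φψ)(x) = Δφ(x) ψ(x + w) + φ(x) Δψ(x)`.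
    convert (ih (hφ w) (hψ.translate w) (by omega)).add (ih hφ (hψ w) (by omega)) using 2
    ring

theorem DiffDegreeLT.const (a : K) : DiffDegreeLT 1 (fun _ : E => a) := by
  intro w x
  simp

theorem DiffDegreeLT.addMonoidHom (ℓ : E →+ K) : DiffDegreeLT 2 ℓ := by
  intro w
  convert DiffDegreeLT.const (E := E) (ℓ w) using 2
  simp

end FiniteDifferences

/-! ### Boundedness along arithmetic progressions -/

section BoundedOn

variable {E K : Type*} [NormedCommRing K]

/-- `φ` is bounded on `F`. -/
def BoundedOn (F : Set E) (φ : E → K) : Prop := ∃ C, ∀ x ∈ F, ‖φ x‖ ≤ C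

theorem BoundedOn.add {F : Set E} {φ ψ : E → K} (hφ : BoundedOn F φ) (hψ : BoundedOn F ψ) :
    BoundedOn F (fun x => φ x + ψ x) := by
  obtain ⟨C, hC⟩ := hφ
  obtain ⟨D, hD⟩ := hψ
  exact ⟨C + D, fun x hx => (norm_add_le _ _).trans (add_le_add (hC x hx) (hD x hx))⟩

theorem BoundedOn.sub {F : Set E} {φ ψ : E → K} (hφ : BoundedOn F φ) (hψ : BoundedOn F ψ) :
    BoundedOn F (fun x => φ x - ψ x) := by
  obtain ⟨C, hC⟩ := hφ
  obtain ⟨D, hD⟩ := hψ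
  exact ⟨C + D, fun x hx => (norm_sub_le _ _).trans (add_le_add (hC x hx) (hD x hx))⟩

/-- Discrete interpolation: along steps of `h`, the first `d` values control all later ones, by
summing differences of lower degree. -/
theorem DiffDegreeLT.boundedOn_translate_nsmul [AddCommGroup E] {d : ℕ} {φ : E → K} (hφ : DiffDegreeLT d φ)
    {F : Set E} {h : E} (hb : ∀ k < d, BoundedOn F (fun x => φ (x + k • h))) (k : ℕ) :
    BoundedOn F (fun x => φ (x + k • h)) := by
  induction d generalizing φ k with
  | zero => exact ⟨0, fun x _ => by simp [hφ (x + k • h)]⟩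
  | succ d ih =>
    have key : ∀ k, BoundedOn F (fun x => φ (x + k • h + h) - φ (x + k • h)) :=
      ih (hφ h) fun k hk => by
        convert (hb (k + 1) (by omega)).sub (hb k (by omega)) using 4
        rw [succ_nsmul, add_assoc]
    induction k with
    | zero => exact hb 0 (by omega)
    | succ k ihk =>
      convert (key k).add ihk using 2
      rw [succ_nsmul, add_assoc]
      ring

end BoundedOn

/-! ### Invariance under the unbounded directions -/

section Invariance

variable {K : Type*} [RCLike K]

/-- Additivity makes the derivative constant, so the map equals its derivative at `0`.
Differentiability over `K` is what gives `ℂ`-linearity, not only `ℝ`-linearity, when `K = ℂ`. -/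
theorem exists_linearMap_of_additive_of_differentiable {E : Type*} [NormedAddCommGroup E]
    [NormedSpace K E] {ψ : E → K} (hadd : ∀ x y, ψ (x + y) = ψ x + ψ y)
    (hd : Differentiable K ψ) : ∃ ℓ : E →L[K] K, ∀ x, ℓ x = ψ x := by
  have h0 : ψ 0 = 0 := by simpa using hadd 0 0
  have hder : ∀ y, HasFDerivAt ψ (fderiv K ψ 0) y := fun y => by
    have h1 : HasFDerivAt ψ (fderiv K ψ 0) (y - y) := by
      rw [sub_self]
      exact (hd 0).hasFDerivAt
    have h2 : HasFDerivAt (fun z => z - y) (ContinuousLinearMap.id K E) y :=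
      (hasFDerivAt_id y).sub_const y
    have h3 := (HasFDerivAt.comp (f := fun z => z - y) y h1 h2).add_const (ψ y)
    rw [ContinuousLinearMap.comp_id] at h3
    exact h3.congr_of_eventuallyEq (Filter.Eventually.of_forall fun z => by
      simp only [Function.comp_apply, ← hadd, sub_add_cancel])
  have hz : ∀ y, fderiv K (fun z => ψ z - fderiv K ψ 0 z) y = 0 := fun y => by
    have := (hder y).sub (fderiv K ψ 0).hasFDerivAt
    rw [sub_self] at this
    exact this.fderiv
  refine ⟨fderiv K ψ 0, fun x => ?_⟩
  have := is_const_of_fderiv_eq_zero (𝕜 := K)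
    (fun y => (hd y).sub (fderiv K ψ 0).differentiableAt) hz x 0
  have h4 : ψ x - fderiv K ψ 0 x = ψ 0 - fderiv K ψ 0 0 := this
  rw [h0, map_zero, sub_zero] at h4
  exact (sub_eq_zero.mp h4).symm

/-- A polynomial function all of whose translates are bounded on `F` is invariant under the
common kernel of the linear forms which are bounded on `F`. -/
theorem DiffDegreeLT.invariant {E : Type*} [NormedAddCommGroup E] [NormedSpace K E]
    [FiniteDimensional K E] {F : Set E} {N : Submodule K E}
    (hN : ∀ ℓ : E →L[K] K, BoundedOn F ℓ → ∀ v ∈ N, ℓ v = 0)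
    {q : E →L[K] E} (hq : ∀ x, x - q x ∈ N) (hqN : ∀ v ∈ N, q v = 0)
    (hqF : Bornology.IsBounded (q '' F))
    {d : ℕ} {φ : E → K} (hd : DiffDegreeLT d φ) (hdiff : Differentiable K φ)
    (hb : ∀ w, BoundedOn F (fun x => φ (x + w))) :
    ∀ v ∈ N, ∀ x, φ (x + v) = φ x := by
  induction d generalizing φ with
  | zero => intro v _ x; rw [hd, hd]
  | succ d ih =>
    -- The difference of `φ` in direction `w` is `N`-invariant by induction; comparing its values at
    -- `v` and `0` shows that `φ` is affine along `N`.
    have key : ∀ v ∈ N, ∀ w, φ (w + v) = φ w + (φ v - φ 0) := fun v hv w => by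
      have := ih (hd w) ((hdiff.comp (differentiable_id.add_const w)).sub hdiff)
        (fun u => by
          convert (hb (u + w)).sub (hb u) using 3
          rw [add_assoc]) v hv 0
      simp only [zero_add] at this
      rw [add_comm w v]
      linear_combination this
    obtain ⟨ℓ, hℓ⟩ := exists_linearMap_of_additive_of_differentiable
      (ψ := fun x => φ (x - q x) - φ 0)
      (fun x y => by
        have := key _ (hq y) (x - q x)
        rw [map_add, show x + y - (q x + q y) = x - q x + (y - q y) by abel, this]
        ring)
      ((hdiff.comp (differentiable_id.sub q.differentiable)).sub_const _)
    -- On `F`, `ℓ x = φ x - φ (q x)`: the first term is bounded by hypothesis, the second because `q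
    -- '' F` is relatively compact.
    have hℓF : BoundedOn F ℓ := by
      have : ProperSpace E := FiniteDimensional.proper K E
      obtain ⟨C, hC⟩ := (hqF.isCompact_closure.image hdiff.continuous).isBounded.exists_norm_le
      obtain ⟨D, hD⟩ := hb 0
      refine ⟨D + C, fun x hx => ?_⟩
      have h1 := key _ (hq x) (q x)
      rw [add_sub_cancel] at h1
      have h2 : ℓ x = φ (x + 0) - φ (q x) := by
        rw [hℓ, add_zero, h1]
        ring
      rw [h2]
      exact (norm_sub_le _ _).trans (add_le_add (hD x hx)
        (hC _ ⟨q x, subset_closure ⟨x, hx, rfl⟩, rfl⟩))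
    intro v hv x
    have h3 := hN ℓ hℓF v hv
    rw [hℓ, hqN v hv, sub_zero] at h3
    rw [key v hv x, h3, add_zero]

end Invariance

/-! ### Dimension of a linear subspace -/

section Dimension

variable {K : Type*} [RCLike K]

/-- The pullback of polynomial functions along a linear mapping. -/
noncomputable def linearPullback {k N : ℕ} (T : (Fin k → K) →ₗ[K] (Fin N → K)) :
    MvPolynomial (Fin N) K →ₐ[K] MvPolynomial (Fin k) K :=
  MvPolynomial.aeval fun j => ∑ i, MvPolynomial.C (T (Pi.single i 1) j) * MvPolynomial.X i

theorem eval_linearPullback {k N : ℕ} (T : (Fin k → K) →ₗ[K] (Fin N → K)) (x : Fin k → K)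
    (P : MvPolynomial (Fin N) K) :
    MvPolynomial.eval x (linearPullback T P) = MvPolynomial.eval (T x) P := by
  have hx : ∀ j, T x j = ∑ i, T (Pi.single i 1) j * x i := fun j => by
    conv_lhs => rw [pi_eq_sum_univ' x]
    simp [mul_comm]
  induction P using MvPolynomial.induction_on with
  | C a => simp [linearPullback]
  | add P Q hP hQ => rw [map_add, map_add, map_add, hP, hQ]
  | mul_X P j hP =>
    rw [map_mul, map_mul, map_mul, hP, MvPolynomial.eval_X, hx]
    simp [linearPullback]

theorem linearPullback_comp {k N M : ℕ} (T : (Fin k → K) →ₗ[K] (Fin N → K))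
    (U : (Fin N → K) →ₗ[K] (Fin M → K)) (P : MvPolynomial (Fin M) K) :
    linearPullback T (linearPullback U P) = linearPullback (U ∘ₗ T) P :=
  MvPolynomial.funext fun x => by simp [eval_linearPullback]

theorem linearPullback_id {k : ℕ} (P : MvPolynomial (Fin k) K) :
    linearPullback LinearMap.id P = P :=
  MvPolynomial.funext fun x => by simp [eval_linearPullback]

/-- Pullback along `T` is surjective, thanks to a left inverse of `T`, and its kernel is the
vanishing ideal because `K` is infinite. So the coordinate ring is a polynomial ring in `k`
variables. -/
theorem projDim_of_cone_eq_range {k N : ℕ} {S : Set (ℙ K (Fin N → K))}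
    (T : (Fin k → K) →ₗ[K] (Fin N → K)) (hT : Function.Injective T)
    (hS : cone S = Set.range T) : projDim S = (k : ℤ) - 1 := by
  obtain ⟨U, hU⟩ := T.exists_leftInverse_of_injective (LinearMap.ker_eq_bot.mpr hT)
  have hsurj : Function.Surjective (linearPullback T) := fun P =>
    ⟨linearPullback U P, by rw [linearPullback_comp, hU, linearPullback_id]⟩
  have hker : MvPolynomial.vanishingIdeal K (cone S) = RingHom.ker (linearPullback T) := by
    ext P
    rw [MvPolynomial.mem_vanishingIdeal_iff, hS, Set.forall_mem_range, RingHom.mem_ker]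
    refine ⟨fun h => MvPolynomial.funext fun x => ?_, fun h x => ?_⟩
    · rw [eval_linearPullback, map_zero, ← h x, MvPolynomial.aeval_eq_eval]
    · have := eval_linearPullback T x P
      rw [h, map_zero] at this
      rw [MvPolynomial.aeval_eq_eval]
      exact this.symm
  have hdim : ringKrullDim (CoordRing S) = k := by
    rw [ringKrullDim_eq_of_ringEquiv ((Ideal.quotEquivOfEq hker).trans
      (RingHom.quotientKerEquivOfSurjective (f := (linearPullback T).toRingHom) hsurj)),
      MvPolynomial.ringKrullDim_of_isNoetherianRing]
    simp
  obtain ⟨d, hd, hd'⟩ := ringKrullDim_coordRing S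
  rw [hdim] at hd
  have : k = d := by exact_mod_cast hd
  rw [hd', this]

end Dimension

/-! ### Points at infinity -/

section Infinity

variable {K : Type*} [RCLike K] {n : ℕ}

/-- The inclusion `v ↦ (v, 0)` of `Kⁿ` as the cone over the hyperplane at infinity. -/
def snocZero (K : Type*) [RCLike K] (n : ℕ) :
    EuclideanSpace K (Fin n) →ₗ[K] (Fin (n + 1) → K) where
  toFun v := Fin.snoc (α := fun _ => K) v 0
  map_add' v w := by
    ext i
    refine Fin.lastCases ?_ (fun i => ?_) i <;> simp
  map_smul' a v := by
    ext i
    refine Fin.lastCases ?_ (fun i => ?_) i <;> simp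

theorem snocZero_injective : Function.Injective (snocZero K n) := fun v w h => by
  ext i
  simpa [snocZero] using congrFun h i.castSucc

theorem mk_mem_hyperplaneAtInfinity {u : Fin (n + 1) → K} (hu : u ≠ 0) :
    Projectivization.mk K u hu ∈ hyperplaneAtInfinity K n ↔ u (Fin.last n) = 0 := by
  obtain ⟨a, ha⟩ := Projectivization.exists_smul_eq_mk_rep K u hu
  rw [hyperplaneAtInfinity, Set.mem_ofPred_eq, ← ha, Pi.smul_apply, Units.smul_def, smul_eq_mul,
    mul_eq_zero, or_iff_right a.ne_zero]

theorem continuous_projectivization_mk' {V : Type*} [AddCommGroup V] [Module K V]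
    [TopologicalSpace V] : Continuous (Projectivization.mk' K (V := V)) :=
  continuous_coinduced_rng

/-- Both sides are homogeneous, so the choice of representative is irrelevant. -/
theorem norm_rep_le_iff (ℓ : EuclideanSpace K (Fin n) →L[K] K) (C : ℝ)
    {u : Fin (n + 1) → K} (hu : u ≠ 0) :
    ‖ℓ (WithLp.toLp 2 (Fin.init (Projectivization.mk K u hu).rep))‖ ≤
        C * ‖(Projectivization.mk K u hu).rep (Fin.last n)‖ ↔
      ‖ℓ (WithLp.toLp 2 (Fin.init u))‖ ≤ C * ‖u (Fin.last n)‖ := by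
  obtain ⟨a, ha⟩ := Projectivization.exists_smul_eq_mk_rep K u hu
  rw [← ha]
  have h1 : WithLp.toLp 2 (Fin.init (a • u)) =
      (a : K) • (WithLp.toLp 2 (Fin.init u) : EuclideanSpace K (Fin n)) := rfl
  have h2 : (a • u) (Fin.last n) = (a : K) * u (Fin.last n) := rfl
  rw [h1, h2, map_smul, smul_eq_mul, norm_mul, norm_mul, mul_left_comm,
    mul_le_mul_iff_right₀ (norm_pos_iff.mpr a.ne_zero)]

/-- The points of projective space where a linear form is dominated by the last coordinate form
a closed set. -/
theorem isClosed_setOf_norm_le (ℓ : EuclideanSpace K (Fin n) →L[K] K) (C : ℝ) :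
    IsClosed {P : ProjSpace K n |
      ‖ℓ (WithLp.toLp 2 (Fin.init P.rep))‖ ≤ C * ‖P.rep (Fin.last n)‖} := by
  refine isClosed_coinduced.mpr ?_
  have : Projectivization.mk' K ⁻¹' {P : ProjSpace K n |
      ‖ℓ (WithLp.toLp 2 (Fin.init P.rep))‖ ≤ C * ‖P.rep (Fin.last n)‖} =
      {u | ‖ℓ (WithLp.toLp 2 (Fin.init u.1))‖ ≤ C * ‖u.1 (Fin.last n)‖} := by
    ext u
    exact norm_rep_le_iff ℓ C u.2
  rw [this]
  have hinit : Continuous fun u : {u : Fin (n + 1) → K // u ≠ 0} =>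
      (WithLp.toLp 2 (Fin.init u.1) : EuclideanSpace K (Fin n)) :=
    (PiLp.continuous_toLp 2 _).comp
      (continuous_pi fun i => (continuous_apply i.castSucc).comp continuous_subtype_val)
  exact isClosed_le (ℓ.continuous.comp hinit).norm
    (continuous_const.mul ((continuous_apply (Fin.last n)).comp continuous_subtype_val).norm)

/-- If `N` is the common kernel of the linear forms bounded on `F`, and `F` is invariant under
translations by `N`, then the directions at infinity of `F` are those of `N`. -/
theorem cone_accumulationAtInfinity {F : Set (EuclideanSpace K (Fin n))}
    {N : Submodule K (EuclideanSpace K (Fin n))}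
    (hN : ∀ v, v ∈ N ↔ ∀ ℓ : EuclideanSpace K (Fin n) →L[K] K, BoundedOn F ℓ → ℓ v = 0)
    (hF : ∀ v ∈ N, ∀ x ∈ F, x + v ∈ F) :
    cone (accumulationAtInfinity F) = Set.range (snocZero K n ∘ₗ N.subtype) := by
  ext u
  by_cases hu : u = 0
  · subst hu
    exact iff_of_true (fun h => absurd rfl h) ⟨0, map_zero _⟩
  have hmem : u ∈ cone (accumulationAtInfinity F) ↔
      Projectivization.mk K u hu ∈ closure (embed '' F) ∧ u (Fin.last n) = 0 := by
    rw [← mk_mem_hyperplaneAtInfinity hu]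
    exact ⟨fun h => h hu, fun h _ => h⟩
  rw [hmem]
  constructor
  · rintro ⟨hcl, hlast⟩
    refine ⟨⟨WithLp.toLp 2 (Fin.init u), (hN _).mpr fun ℓ ⟨C, hC⟩ => ?_⟩, ?_⟩
    -- The bound on `ℓ` becomes a closed homogeneous condition, which at infinity reads `ℓ = 0`.
    · have hsub : embed '' F ⊆ {P : ProjSpace K n |
          ‖ℓ (WithLp.toLp 2 (Fin.init P.rep))‖ ≤ C * ‖P.rep (Fin.last n)‖} := by
        rintro _ ⟨x, hx, rfl⟩
        refine (norm_rep_le_iff ℓ C _).mpr ?_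
        rw [Fin.init_snoc, Fin.snoc_last, norm_one, mul_one]
        exact hC x hx
      have := (norm_rep_le_iff ℓ C hu).mp
        (closure_minimal hsub (isClosed_setOf_norm_le ℓ C) hcl)
      rw [hlast, norm_zero, mul_zero] at this
      exact norm_le_zero_iff.mp this
    · ext i
      refine Fin.lastCases ?_ (fun i => ?_) i
      · simp [snocZero, hlast]
      · simp [snocZero, Fin.init]
  · rintro ⟨⟨v, hv⟩, rfl⟩
    refine ⟨?_, by simp [snocZero]⟩
    obtain ⟨x, hx⟩ : F.Nonempty := by
      by_contra hempty
      -- On the empty set all forms are bounded, so `N = 0`, against `u ≠ 0`.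
      rw [Set.not_nonempty_iff_eq_empty] at hempty
      apply hu
      have hv0 : v = 0 := by
        ext i
        exact (hN v).mp hv (EuclideanSpace.proj i) ⟨0, by simp [hempty]⟩
      simp [hv0]
    -- These points stay in `F`; rescaled by `(j + 1)⁻¹`, their homogeneous coordinates tend to `(v,
    -- 0)`.
    let y : ℕ → EuclideanSpace K (Fin n) := fun j => x + ((j : K) + 1) • v
    have hpos : ∀ j : ℕ, (j : K) + 1 ≠ 0 := fun j => Nat.cast_add_one_ne_zero j
    let w : ℕ → Fin (n + 1) → K := fun j =>
      Fin.snoc (α := fun _ => K) (((j : K) + 1)⁻¹ • x + v) ((j : K) + 1)⁻¹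
    have hw : ∀ j, w j ≠ 0 := fun j h => by
      have := congrFun h (Fin.last n)
      simp only [w, Fin.snoc_last, Pi.zero_apply, inv_eq_zero] at this
      exact hpos j this
    have hmk : ∀ j, Projectivization.mk K (w j) (hw j) = embed (y j) := fun j => by
      refine (Projectivization.mk_eq_mk_iff' K _ _ _ _).mpr ⟨((j : K) + 1)⁻¹, ?_⟩
      ext i
      refine Fin.lastCases ?_ (fun i => ?_) i
      · simp [w]
      · simp [w, y, mul_add, inv_mul_cancel_left₀ (hpos j)]
    have hlim0 : Filter.Tendsto (fun j : ℕ => ((j : K) + 1)⁻¹) Filter.atTop (𝓝 0) := by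
      have := tendsto_one_div_add_atTop_nhds_zero_nat (𝕜 := K)
      simpa using this
    have hlim : Filter.Tendsto w Filter.atTop (𝓝 (snocZero K n v)) := by
      refine tendsto_pi_nhds.mpr fun i => ?_
      refine Fin.lastCases ?_ (fun i => ?_) i
      · simpa [w, snocZero] using hlim0
      · simpa [w, snocZero] using (hlim0.mul_const (x i)).add_const (v i)
    have hlim' : Filter.Tendsto (fun j => (⟨w j, hw j⟩ : {u : Fin (n + 1) → K // u ≠ 0}))
        Filter.atTop (𝓝 ⟨snocZero K n v, hu⟩) := tendsto_subtype_rng.mpr hlim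
    have hlim'' := (continuous_projectivization_mk' (K := K).tendsto _).comp hlim'
    exact mem_closure_of_tendsto hlim'' (Filter.Eventually.of_forall fun j =>
      ⟨y j, hF _ (N.smul_mem _ hv) x hx, (hmk j).symm⟩)

end Infinity

/-! ### Polynomial mappings -/

section PolynomialMaps

variable {K : Type*} [RCLike K] {n p m : ℕ}

theorem exists_diffDegreeLT_eval (P : MvPolynomial (Fin n) K) :
    ∃ d, DiffDegreeLT d (fun x : EuclideanSpace K (Fin n) => MvPolynomial.eval x P) := by
  induction P using MvPolynomial.induction_on with
  | C a => exact ⟨1, by simpa using DiffDegreeLT.const a⟩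
  | add P Q hP hQ =>
    obtain ⟨d, hd⟩ := hP
    obtain ⟨e, he⟩ := hQ
    exact ⟨max d e, by simpa using (hd.mono (le_max_left d e)).add (he.mono (le_max_right d e))⟩
  | mul_X P i hP =>
    obtain ⟨d, hd⟩ := hP
    refine ⟨d + 2, ?_⟩
    convert hd.mul (DiffDegreeLT.addMonoidHom
      (EuclideanSpace.proj i : EuclideanSpace K (Fin n) →L[K] K).toLinearMap.toAddMonoidHom) using 2
    simp

theorem differentiable_eval (P : MvPolynomial (Fin n) K) :
    Differentiable K (fun x : EuclideanSpace K (Fin n) => MvPolynomial.eval x P) := by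
  induction P using MvPolynomial.induction_on with
  | C a => simp
  | add P Q hP hQ =>
    simp only [map_add]
    exact hP.add hQ
  | mul_X P i hP =>
    simp only [map_mul, MvPolynomial.eval_X]
    exact hP.mul (EuclideanSpace.proj i : EuclideanSpace K (Fin n) →L[K] K).differentiable

theorem IsPolynomialMap.continuous {f : EuclideanSpace K (Fin n) → EuclideanSpace K (Fin p)}
    (hf : IsPolynomialMap f) : Continuous f := by
  obtain ⟨P, hP⟩ := hf
  refine (PiLp.continuous_toLp 2 _).comp (continuous_pi (f := fun x i => f x i) fun i => ?_)
  simp only [hP]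
  exact (differentiable_eval (P i)).continuous

theorem IsPolynomialMap.comp_linearMap {f : EuclideanSpace K (Fin n) → EuclideanSpace K (Fin p)}
    (hf : IsPolynomialMap f) (σ : EuclideanSpace K (Fin m) →ₗ[K] EuclideanSpace K (Fin n)) :
    IsPolynomialMap (f ∘ σ) := by
  obtain ⟨P, hP⟩ := hf
  let T : (Fin m → K) →ₗ[K] (Fin n → K) :=
    (WithLp.linearEquiv 2 K (Fin n → K)).toLinearMap ∘ₗ σ ∘ₗ
      (WithLp.linearEquiv 2 K (Fin m → K)).symm.toLinearMap
  exact ⟨fun i => linearPullback T (P i), fun x i => by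
    rw [eval_linearPullback, Function.comp_apply, hP]
    rfl⟩

end PolynomialMaps

/-! ### Consequences of Lipschitz triviality -/

section Tube

variable {K : Type*} [RCLike K] {n p : ℕ}

/-- Around a Lipschitz trivial value the fibres stay at bounded distance from the central fibre,
and the tube over a ball contains a uniform neighbourhood of the central fibre. -/
theorem IsLipschitzTrivialValue.exists_tube
    {f : EuclideanSpace K (Fin n) → EuclideanSpace K (Fin p)} (hf : Continuous f)
    {c : EuclideanSpace K (Fin p)} (hc : IsLipschitzTrivialValue f c) :
    ∃ r > 0, ∃ R, ∃ δ > 0,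
      (∀ y, dist (f y) c ≤ r → ∃ x ∈ f ⁻¹' {c}, dist y x ≤ R) ∧
      ∀ x ∈ f ⁻¹' {c}, ∀ y, dist y x < δ → dist (f y) c ≤ r := by
  obtain ⟨V, hV, H, hH, L, hL, hL'⟩ := hc
  obtain ⟨r, hr, hrV⟩ := Metric.nhds_basis_closedBall.mem_iff.mp hV
  have hcV : c ∈ V := mem_of_mem_nhds hV
  have hsnd : ∀ z : ↥(f ⁻¹' V), (((H.symm z).2 : V) : EuclideanSpace K (Fin p)) = f z := fun z => by
    have := hH (H.symm z).1 (H.symm z).2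
    rw [Prod.mk.eta, H.apply_symm_apply] at this
    exact this.symm
  -- Over `V`, `f` is the second component of `H.symm`.
  have hlip : ∀ y y', f y ∈ V → f y' ∈ V → dist (f y) (f y') ≤ L * dist y y' :=
    fun y y' hy hy' => by
      have h1 := hL'.dist_le_mul ⟨y, hy⟩ ⟨y', hy'⟩
      have h2 := (le_max_right _ _).trans h1
      rwa [Subtype.dist_eq, hsnd, hsnd] at h2
  have hpos : (0 : ℝ) < L + 1 := by positivity
  refine ⟨r, hr, L * r, r / (L + 1), by positivity, fun y hy => ?_, fun x hx y hy => ?_⟩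
  · have hyV : f y ∈ V := hrV hy
    refine ⟨H ((H.symm ⟨y, hyV⟩).1, ⟨c, hcV⟩), hH _ _, ?_⟩
    have h1 := hL.dist_le_mul (H.symm ⟨y, hyV⟩) ((H.symm ⟨y, hyV⟩).1, ⟨c, hcV⟩)
    rw [H.apply_symm_apply, Prod.dist_eq, dist_self, max_eq_right dist_nonneg, Subtype.dist_eq,
      Subtype.dist_eq, hsnd] at h1
    exact h1.trans (mul_le_mul_of_nonneg_left hy L.2)
  -- `f y` may lie outside `V`, where no Lipschitz bound is known; the intermediate value theorem
  -- replaces `y` by a point `z` with `f z` on the sphere of radius `r`, inside `V`.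
  · by_contra! hlt
    have hfx : f x = c := hx
    have hconn : IsPreconnected (Metric.ball x (r / (L + 1))) :=
      (convex_ball x _).isPreconnected
    obtain ⟨z, hz, hzr⟩ := hconn.intermediate_value (f := fun y => dist (f y) c)
      (Metric.mem_ball_self (by positivity)) hy
      (hf.dist continuous_const).continuousOn ⟨by simpa [hfx] using hr.le, hlt.le⟩
    have hzr' : dist (f z) c = r := hzr
    have h1 := hlip z x (hrV hzr'.le) (hfx ▸ hcV)
    rw [hfx, hzr'] at h1
    have h2 : dist z x * (L + 1) < r := (lt_div_iff₀ hpos).mp hz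
    nlinarith [dist_nonneg (x := z) (y := x)]

/-- All translates of a polynomial which is bounded on a uniform neighbourhood of `F` are bounded
on `F`. -/
theorem boundedOn_translate_eval {F : Set (EuclideanSpace K (Fin n))}
    {P : MvPolynomial (Fin n) K} {δ C : ℝ} (hδ : 0 < δ)
    (h : ∀ x ∈ F, ∀ y, dist y x < δ → ‖MvPolynomial.eval y P‖ ≤ C) (w : EuclideanSpace K (Fin n)) :
    BoundedOn F (fun x => MvPolynomial.eval (x + w) P) := by
  obtain ⟨d, hd⟩ := exists_diffDegreeLT_eval P
  -- With step `w / M`, the first `d` translates move points by less than `δ`, and the `M`-th is the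
  -- translate by `w`.
  obtain ⟨M, hM⟩ := exists_nat_gt (d * ‖w‖ / δ)
  have hM0 : (0 : ℝ) < M := lt_of_le_of_lt (by positivity) hM
  have hMK : (M : K) ≠ 0 := Nat.cast_ne_zero.mpr fun h => by simp [h] at hM0
  have hb := hd.boundedOn_translate_nsmul (F := F) (h := (M : K)⁻¹ • w) (fun k hk => ⟨C, fun x hx =>
    h x hx _ (by
      rw [dist_eq_norm, add_sub_cancel_left, ← Nat.cast_smul_eq_nsmul K, norm_smul, norm_smul,
        norm_inv, RCLike.norm_natCast, RCLike.norm_natCast, ← mul_assoc, ← div_eq_mul_inv,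
        div_mul_eq_mul_div, div_lt_iff₀ hM0]
      rw [div_lt_iff₀ hδ] at hM
      have hk' : (k : ℝ) ≤ d := by exact_mod_cast hk.le
      nlinarith [mul_le_mul_of_nonneg_right hk' (norm_nonneg w)])⟩) M
  have hMw : M • (M : K)⁻¹ • w = w := by
    rw [← Nat.cast_smul_eq_nsmul K, smul_inv_smul₀ hMK]
  simpa only [hMw] using hb

end Tube

/-! ### Bounded forms and unbounded directions -/

section Directions

variable {K : Type*} [RCLike K] {n : ℕ}

/-- The space of linear forms which are bounded on `F`. -/
def boundedForms (F : Set (EuclideanSpace K (Fin n))) :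
    Submodule K (Module.Dual K (EuclideanSpace K (Fin n))) where
  carrier := {ℓ | BoundedOn F ℓ}
  zero_mem' := ⟨0, by simp⟩
  add_mem' h h' := h.add h'
  smul_mem' a ℓ h := by
    obtain ⟨C, hC⟩ := h
    refine ⟨‖a‖ * C, fun x hx => ?_⟩
    rw [LinearMap.smul_apply, norm_smul]
    exact mul_le_mul_of_nonneg_left (hC x hx) (norm_nonneg a)

/-- The common kernel of the linear forms which are bounded on `F`. -/
def unboundedDirections (F : Set (EuclideanSpace K (Fin n))) :
    Submodule K (EuclideanSpace K (Fin n)) :=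
  (boundedForms F).dualCoannihilator

theorem mem_unboundedDirections {F : Set (EuclideanSpace K (Fin n))}
    {v : EuclideanSpace K (Fin n)} : v ∈ unboundedDirections F ↔
      ∀ ℓ : EuclideanSpace K (Fin n) →L[K] K, BoundedOn F ℓ → ℓ v = 0 := by
  rw [unboundedDirections, Submodule.mem_dualCoannihilator]
  exact ⟨fun h ℓ hℓ => h ℓ.toLinearMap hℓ, fun h ℓ hℓ => h (LinearMap.toContinuousLinearMap ℓ) hℓ⟩

/-- A set is bounded modulo its unbounded directions. -/
theorem isBounded_image_of_unboundedDirections {F : Set (EuclideanSpace K (Fin n))}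
    {q : EuclideanSpace K (Fin n) →L[K] EuclideanSpace K (Fin n)}
    (hq : ∀ v ∈ unboundedDirections F, q v = 0) : Bornology.IsBounded (q '' F) := by
  have hb : ∀ i, BoundedOn F (fun x => q x i) := fun i => by
    -- A coordinate of `q` kills `N`, so by finite-dimensional biduality it is itself a bounded
    -- form.
    have hmem : (EuclideanSpace.proj i ∘L q).toLinearMap ∈
        (unboundedDirections F).dualAnnihilator :=
      (Submodule.mem_dualAnnihilator _).mpr fun v hv => by simp [hq v hv]
    rw [unboundedDirections, Subspace.dualCoannihilator_dualAnnihilator_eq] at hmem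
    exact hmem
  choose C hC using hb
  have h1 : Bornology.IsBounded ((WithLp.ofLp : EuclideanSpace K (Fin n) → Fin n → K) '' (q '' F)) := by
    refine isBounded_iff_forall_norm_le.mpr ⟨∑ i, |C i|, ?_⟩
    rintro _ ⟨_, ⟨x, hx, rfl⟩, rfl⟩
    refine (pi_norm_le_iff_of_nonneg (Finset.sum_nonneg fun i _ => abs_nonneg _)).mpr fun i => ?_
    exact ((hC i x hx).trans (le_abs_self _)).trans
      (Finset.single_le_sum (f := fun i => |C i|) (fun i _ => abs_nonneg _) (Finset.mem_univ i))
  have h2 := (PiLp.lipschitzWith_toLp 2 (fun _ : Fin n => K)).isBounded_image h1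
  rwa [Set.image_image, Set.image_id'] at h2

end Directions

end LipschitzTrivial

/-! ### The factorization -/

open LipschitzTrivial in
theorem theorem3p1 {K : Type*} [RCLike K] {n p m : ℕ}
    (f : EuclideanSpace K (Fin n) → EuclideanSpace K (Fin p))
    (hf : LipschitzTrivial.IsPolynomialMap f)
    (c : EuclideanSpace K (Fin p))
    (hdim : LipschitzTrivial.projDim (LipschitzTrivial.accumulationAtInfinity (f ⁻¹' {c})) =
      (n : ℤ) - 1 - m)
    (hc : LipschitzTrivial.IsLipschitzTrivialValue f c) :
    ∃ (g : EuclideanSpace K (Fin m) → EuclideanSpace K (Fin p))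
      (π : EuclideanSpace K (Fin n) →ₗ[K] EuclideanSpace K (Fin m)),
      LipschitzTrivial.IsPolynomialMap g ∧ LipschitzTrivial.IsProperAt g c ∧
        Function.Surjective π ∧ f = g ∘ π := by
  obtain ⟨P, hP⟩ := id hf
  obtain ⟨r, hr, R, δ, hδ, htube, hball⟩ := hc.exists_tube hf.continuous
  let F := f ⁻¹' {c}
  let N := unboundedDirections F
  obtain ⟨σ, hσ⟩ := N.mkQ.exists_rightInverse_of_surjective N.range_mkQ
  have hσ' : ∀ z, N.mkQ (σ z) = z := fun z => LinearMap.congr_fun hσ z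
  -- `q` is the projection with kernel `N` onto the complement given by the section `σ`.
  let q := LinearMap.toContinuousLinearMap (σ ∘ₗ N.mkQ)
  have hqN : ∀ v ∈ N, q v = 0 := fun v hv => by
    change σ (N.mkQ v) = 0
    rw [Submodule.mkQ_apply, (Submodule.Quotient.mk_eq_zero N).mpr hv, map_zero]
  have hq : ∀ x, x - q x ∈ N := fun x => by
    rw [← Submodule.ker_mkQ N, LinearMap.mem_ker, map_sub]
    exact sub_eq_zero.mpr (hσ' _).symm
  have hqF : Bornology.IsBounded (q '' F) := isBounded_image_of_unboundedDirections hqN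
  have hinv : ∀ v ∈ N, ∀ x, f (x + v) = f x := fun v hv x => by
    ext i
    rw [hP, hP]
    obtain ⟨d, hd⟩ := exists_diffDegreeLT_eval (P i)
    refine hd.invariant (fun ℓ hℓ v hv => mem_unboundedDirections.mp hv ℓ hℓ) hq hqN hqF
      (differentiable_eval (P i)) (boundedOn_translate_eval (C := r + ‖c‖) hδ fun x hx y hy => ?_)
      v hv x
    have h1 := hball x hx y hy
    rw [← hP]
    have h2 := norm_add_le (f y - c) c
    rw [sub_add_cancel] at h2
    rw [dist_eq_norm] at h1
    linarith [PiLp.norm_apply_le (f y) i]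
  have hcone := cone_accumulationAtInfinity (F := F) (N := N) (fun v => mem_unboundedDirections)
    (fun v hv x hx => (hinv v hv x).trans hx)
  have hrank : Module.finrank K (EuclideanSpace K (Fin n) ⧸ N) =
      Module.finrank K (EuclideanSpace K (Fin m)) := by
    let e : (Fin (Module.finrank K N) → K) ≃ₗ[K] N := (Module.finBasis K N).equivFun.symm
    have h1 := projDim_of_cone_eq_range ((snocZero K n ∘ₗ N.subtype) ∘ₗ e.toLinearMap)
      ((snocZero_injective.comp N.injective_subtype).comp e.injective)
      (by rw [hcone, LinearMap.coe_comp _ e.toLinearMap]; exact (e.surjective.range_comp _).symm)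
    have h2 := N.finrank_quotient_add_finrank
    rw [finrank_euclideanSpace_fin] at h2 ⊢
    have h3 := h1.symm.trans hdim
    omega
  let e := LinearEquiv.ofFinrankEq _ _ hrank
  let τ : EuclideanSpace K (Fin m) →ₗ[K] EuclideanSpace K (Fin n) := σ ∘ₗ e.symm.toLinearMap
  let π : EuclideanSpace K (Fin n) →ₗ[K] EuclideanSpace K (Fin m) := e.toLinearMap ∘ₗ N.mkQ
  have hπτ : ∀ z, π (τ z) = z := fun z => by
    change e (N.mkQ (σ (e.symm z))) = z
    rw [hσ', e.apply_symm_apply]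
  have hτπ : ∀ x, τ (π x) = q x := fun x => by
    change σ (e.symm (e (N.mkQ x))) = _
    rw [e.symm_apply_apply]
    rfl
  refine ⟨f ∘ τ, π, hf.comp_linearMap τ, ⟨Metric.closedBall c r, Metric.closedBall_mem_nhds c hr, ?_⟩,
    fun z => ⟨τ z, hπτ z⟩, funext fun x => ?_⟩
  · have hcont : Continuous (f ∘ τ) := (hf.comp_linearMap τ).continuous
    obtain ⟨M, hM⟩ := hqF.exists_norm_le
    have hcompact : IsCompact (f ∘ τ ⁻¹' Metric.closedBall c r) := by
      refine ((isCompact_closedBall (0 : EuclideanSpace K (Fin n)) (‖q‖ * R + M)).image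
        (LinearMap.continuous_of_finiteDimensional π)).of_isClosed_subset
        (Metric.isClosed_closedBall.preimage hcont) fun z hz => ⟨τ z, ?_, hπτ z⟩
      obtain ⟨x, hx, hxR⟩ := htube (τ z) hz
      -- The first term is bounded since `x ∈ F` is within `R` of `τ z`, the second since `q '' F`
      -- is bounded.
      have h1 : τ z = q (τ z - x) + q x := by
        rw [← map_add, sub_add_cancel, ← hτπ, hπτ]
      rw [mem_closedBall_zero_iff, h1]
      refine (norm_add_le _ _).trans (add_le_add ((q.le_opNorm _).trans ?_) (hM _ ⟨x, hx, rfl⟩))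
      rw [← dist_eq_norm]
      exact mul_le_mul_of_nonneg_left hxR (norm_nonneg q)
    have : CompactSpace ↥(f ∘ τ ⁻¹' Metric.closedBall c r) :=
      isCompact_iff_compactSpace.mp hcompact
    exact (hcont.restrictPreimage).isProperMap
  · have h1 := hinv _ (hq x) (q x)
    rw [add_sub_cancel] at h1
    rw [h1, Function.comp_apply, Function.comp_apply, hτπ]
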